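/- **Theorem (Bayesian law of large numbers).** Let $\mathcal P$ be the set of Borel probability measures on $\mathbb R$ dominated by Lebesgue measure, with the weak topology and its Borel $\sigma$-field; densities are denoted by the same letters as measures. Let $X_1,X_2,\dots$ be i.i.d. with density $r\in\mathcal P$, let $\Pi$ be a prior probability measure on $\mathcal P$, and let $\Phi\subseteq\mathcal P$; it is not assumed that $r\in\Phi$. For $q,p\in\mathcal P$ let $L(q\|p)=-\int p\log q$ (with $\log 0=-\infty$, and the value $+\infty$ if the integral is undefined), and for $Q\subseteq\mathcal P$ let $L(Q\|p)=\inf_{q\in Q}L(q\|p)$. An *$L$-projection* of $p$ on $Q$ is a $\hat q\in Q$ with $L(\hat q\|p)=L(Q\|p)$. For $\delta>0$ let $B_\delta(q,p)=\{q'\in\mathcal P: L(q'\|p)<L(q\|p)+\delta\}$. Fix versions $q(x)$ of the densities that are jointly measurable in $(q,x)\in\mathcal P\times\mathbb R$ (such versions exist, and any choice is allowed), and for measurable $Q\subseteq\mathcal P$ let $$\Pi_n(Q\mid X_1^n)=\frac{\int_{Q\cap\Phi}\prod_{i=1}^n q(X_i)\,\Pi(dq)}{\int_{\Phi}\prod_{i=1}^n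 q(X_i)\,\Pi(dq)} .$$ Suppose that $\Phi$ is open in the weak topology, that 1. $\Pi(B_\delta(q,r))>0$ for every $q\in\Phi$ and every $\delta>0$, and 2. $L(\Phi\|r)<\infty$, where also $L(\Phi\|r)>-\infty$. Let $1\le\kappa<\infty$, let $\hat q_1,\dots,\hat q_\kappa$ be $L$-projections of $r$ on $\Phi$, let $\varepsilon>0$, and let $U=\bigcup_{k=1}^\kappa W(\hat q_k,\varepsilon)$, where $W(q,\varepsilon)$ is the open ball with center $q$ and radius $\varepsilon$ for a metric on $\mathcal P$ (any metric) that induces the weak topology. Then, almost surely, $$\lim_{n\to\infty}\Pi_n(U\mid X_1^n)=1 .$$ -/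

import Mathlib

open MeasureTheory ProbabilityTheory Filter Topology
open scoped ENNReal

/-- The set of all Borel probability measures on `ℝ` that are dominated by the Lebesgue measure. -/
def DomProb : Type :=
  {q : ProbabilityMeasure ℝ // (q : Measure ℝ) ≪ (volume : Measure ℝ)}

namespace DomProb

/-- The weak topology: the topology of convergence in distribution, restricted to the dominated
probability measures. -/
noncomputable instance weakTopology : TopologicalSpace DomProb :=
  instTopologicalSpaceSubtype
    (p := fun q : ProbabilityMeasure ℝ => (q : Measure ℝ) ≪ (volume : Measure ℝ))

/-- The Borel σ-field of the weak topology. -/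
noncomputable instance borelSigma : MeasurableSpace DomProb := borel DomProb

instance : BorelSpace DomProb := ⟨rfl⟩

/-- The underlying measure on `ℝ`. -/
def toMeasure (q : DomProb) : Measure ℝ := ((q.1 : ProbabilityMeasure ℝ) : Measure ℝ)

instance (q : DomProb) : IsProbabilityMeasure q.toMeasure := q.1.2

/-- The Lebesgue density of `q`, determined up to Lebesgue null sets. -/
noncomputable def pdf (q : DomProb) : ℝ → ℝ≥0∞ := q.toMeasure.rnDeriv volume

/-- The L-divergence `L(q ‖ p) = - ∫ p log q`, as an extended real number: minus the difference of
the integrals of the positive and of the negative part of `log q` with respect to `p`, where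
`log 0 = -∞`. The value is `⊤` also when both integrals are infinite (then the integral is not
defined). -/
noncomputable def Ldiv (q p : DomProb) : EReal :=
  -(((∫⁻ x, (ENNReal.log (q.pdf x)).toENNReal ∂p.toMeasure : ℝ≥0∞) : EReal)
    - ((∫⁻ x, (-ENNReal.log (q.pdf x)).toENNReal ∂p.toMeasure : ℝ≥0∞) : EReal))

/-- The value `L(Q ‖ p)`, the infimum of `L(q ‖ p)` over `q ∈ Q`. It is the value of the
L-divergence at any L-projection of `p` on `Q`, if there is one. -/
noncomputable def LdivSet (Q : Set DomProb) (p : DomProb) : EReal := ⨅ q ∈ Q, Ldiv q p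

/-- `q₀` is an L-projection of `p` on `Q`: a minimizer of `L(· ‖ p)` over `Q`. -/
def IsLProjection (q₀ : DomProb) (Q : Set DomProb) (p : DomProb) : Prop :=
  q₀ ∈ Q ∧ ∀ q ∈ Q, Ldiv q₀ p ≤ Ldiv q p

/-- The ball `B_ε(q, p)` of all dominated `q'` with `L(q' ‖ p) - L(q ‖ p) < ε`. -/
def LBall (ε : ℝ) (q p : DomProb) : Set DomProb := {q' | Ldiv q' p < Ldiv q p + (ε : EReal)}

/-- A choice, for every `q`, of a version `f q` of the Lebesgue density of `q`, such that
`f q x` is jointly measurable in `(q, x)`. -/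
structure IsDensityVersion (f : DomProb → ℝ → ℝ≥0∞) : Prop where
  measurable : Measurable (Function.uncurry f)
  withDensity_eq : ∀ q : DomProb, (volume : Measure ℝ).withDensity (f q) = q.toMeasure

/-- The likelihood `exp (- l_n(q)) = ∏_{i < n} q(x_i)` of the first `n` observations. -/
noncomputable def likelihood (f : DomProb → ℝ → ℝ≥0∞) (x : ℕ → ℝ) (n : ℕ) (q : DomProb) : ℝ≥0∞ :=
  ∏ i ∈ Finset.range n, f q (x i)

/-- The posterior mass of `Q` (more precisely, of the part of `Q` in the model `Φ`) given the
first `n` observations. -/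
noncomputable def posterior (prior : Measure DomProb) (Φ : Set DomProb)
    (f : DomProb → ℝ → ℝ≥0∞) (x : ℕ → ℝ) (n : ℕ) (Q : Set DomProb) : ℝ≥0∞ :=
  (∫⁻ q in Q ∩ Φ, likelihood f x n q ∂prior) / (∫⁻ q in Φ, likelihood f x n q ∂prior)

/-- The metric `d` induces the weak topology. -/
def MetrizesWeak (d : MetricSpace DomProb) : Prop :=
  d.toUniformSpace.toTopologicalSpace = weakTopology

/-- The open ball `W(q, ε)` of the metric `d`. -/
def weakBall (d : MetricSpace DomProb) (q : DomProb) (ε : ℝ) : Set DomProb :=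
  {q' | d.dist q' q < ε}

/-- The evaluations `q ↦ q(s)` are Borel measurable. -/
theorem measurable_toMeasure : Measurable toMeasure := by
  have h : ∀ s, MeasurableSet s → Measurable fun q : DomProb => q.toMeasure s := by
    intro s hs
    induction s, hs using MeasurableSpace.induction_on_inter
      ((BorelSpace.measurable_eq (α := ℝ)).trans rfl) isPiSystem_isOpen with
    | empty => simp
    | basic G hG =>
      refine LowerSemicontinuous.measurable fun q y hy => ?_
      have hc : Tendsto (fun p : DomProb => p.1) (𝓝 q) (𝓝 q.1) :=
        (continuous_subtype_val (p := fun q : ProbabilityMeasure ℝ =>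
          (q : Measure ℝ) ≪ (volume : Measure ℝ))).tendsto q
      have := ProbabilityMeasure.le_liminf_measure_open_of_tendsto hc (show IsOpen G from hG)
      exact eventually_lt_of_lt_liminf (lt_of_lt_of_le hy this)
    | compl t ht ih =>
      have : (fun q : DomProb => q.toMeasure tᶜ) = fun q => 1 - q.toMeasure t := by
        funext q
        rw [prob_compl_eq_one_sub ht]
      rw [this]
      exact measurable_const.sub ih
    | iUnion g hd hm ih =>
      have : (fun q : DomProb => q.toMeasure (⋃ i, g i)) = fun q => ∑' i, q.toMeasure (g i) := by
        funext q
        rw [measure_iUnion hd hm]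
      rw [this]
      exact Measurable.tsum ih
  exact Measure.measurable_of_measurable_coe _ h

/-- Jointly measurable versions of the densities exist: differentiate along shrinking balls. -/
theorem exists_isDensityVersion : ∃ f, IsDensityVersion f := by
  let κ : Kernel DomProb ℝ := ⟨toMeasure, measurable_toMeasure⟩
  have hκ : IsMarkovKernel κ := ⟨fun q => inferInstanceAs (IsProbabilityMeasure q.toMeasure)⟩
  let g : ℕ → DomProb → ℝ → ℝ≥0∞ := fun n q x =>
    q.toMeasure (Metric.closedBall x (1 / ((n : ℝ) + 1))) /
      volume (Metric.closedBall x (1 / ((n : ℝ) + 1)))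
  refine ⟨fun q x => limsup (fun n => g n q x) atTop, ?_, fun q => ?_⟩
  · refine Measurable.limsup fun n => ?_
    have hs : MeasurableSet {z : (DomProb × ℝ) × ℝ | dist z.2 z.1.2 ≤ 1 / ((n : ℝ) + 1)} :=
      measurableSet_le (measurable_snd.dist (measurable_snd.comp measurable_fst)) measurable_const
    have h1 := Kernel.measurable_kernel_prodMk_left (κ := κ.prodMkRight ℝ) hs
    have h2 : Measurable fun z : DomProb × ℝ =>
        z.1.toMeasure (Metric.closedBall z.2 (1 / ((n : ℝ) + 1))) := h1
    simp only [Real.volume_closedBall, g]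
    exact h2.div measurable_const
  · have hac : q.toMeasure ≪ volume := q.2
    have hae : (fun x => limsup (fun n => g n q x) atTop) =ᵐ[volume]
        q.toMeasure.rnDeriv volume := by
      filter_upwards [Besicovitch.ae_tendsto_rnDeriv q.toMeasure volume] with x hx
      have ht : Tendsto (fun n : ℕ => 1 / ((n : ℝ) + 1)) atTop (𝓝[>] 0) :=
        tendsto_nhdsWithin_iff.2 ⟨tendsto_one_div_add_atTop_nhds_zero_nat,
          Eventually.of_forall fun n => Set.mem_Ioi.2 Nat.one_div_pos_of_nat⟩
      exact (hx.comp ht).limsup_eq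
    rw [withDensity_congr_ae hae, Measure.withDensity_rnDeriv_eq _ _ hac]

end DomProb

/-!
The `L`-divergence is convex, strictly so in the direction of `r`: if `q ≠ r` has finite
`L(q ‖ r)`, then moving `q` a little towards `r` decreases it. An `L`-projection on an open set is
therefore `r` itself, and the theorem reduces to Schwartz's consistency theorem. Dividing the
likelihoods by that of `r` does not change the posterior. For a bounded continuous `k` with
`∫ k dr > 0`, a Chernoff bound makes the integrated likelihood ratio of `{q | ∫ k dq ≤ 0}`
exponentially small; finitely many such sets cover the complement of a weak neighbourhood of `r`.
On an `L`-ball around `r` the likelihood ratios are, by the law of large numbers, not exponentially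
small, and Fatou's lemma transfers this to the total mass.
-/

open scoped BoundedContinuousFunction

section

variable {E : Type*} [MeasurableSpace E] (μ : Measure E) [IsProbabilityMeasure μ]

/-- The law of an infinite i.i.d. sample from `μ`. -/
noncomputable abbrev iidLaw : Measure (ℕ → E) := Measure.infinitePi fun _ => μ

variable {μ}

theorem ae_iidLaw_forall {p : E → Prop} (h : ∀ᵐ y ∂μ, p y) : ∀ᵐ x ∂iidLaw μ, ∀ i, p (x i) :=
  ae_all_iff.2 fun i =>
    (measurePreserving_eval_infinitePi (fun _ => μ) i).quasiMeasurePreserving.ae h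

theorem lintegral_iidLaw_prod {w : E → ℝ≥0∞} (hw : Measurable w) (n : ℕ) :
    ∫⁻ x, ∏ i ∈ Finset.range n, w (x i) ∂iidLaw μ = (∫⁻ y, w y ∂μ) ^ n := by
  have hindep : iIndepFun (fun i (x : ℕ → E) => w (x i)) (iidLaw μ) :=
    iIndepFun_infinitePi fun _ => hw
  have hprod := lintegral_prod_eq_prod_lintegral_of_indepFun (Finset.range n)
    (fun i (x : ℕ → E) => w (x i)) hindep fun i => hw.comp (measurable_pi_apply i)
  have hcoord (i : ℕ) : ∫⁻ x, w (x i) ∂iidLaw μ = ∫⁻ y, w y ∂μ :=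
    (measurePreserving_eval_infinitePi (fun _ => μ) i).lintegral_comp hw
  simpa only [hcoord, Finset.prod_const, Finset.card_range] using hprod

theorem ae_iidLaw_tendsto_average {g : E → ℝ} (hg : Integrable g μ) :
    ∀ᵐ x ∂iidLaw μ, Tendsto (fun n : ℕ => (∑ i ∈ Finset.range n, g (x i)) / n) atTop
      (𝓝 (∫ y, g y ∂μ)) := by
  have hlaw (i : ℕ) : HasLaw (fun x : ℕ → E => x i) μ (iidLaw μ) :=
    (measurePreserving_eval_infinitePi (fun _ => μ) i).hasLaw
  have hgi (i : ℕ) : AEMeasurable g ((iidLaw μ).map fun x => x i) := by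
    rw [(hlaw i).map_eq]
    exact hg.aemeasurable
  have hcoord : iIndepFun (fun i (x : ℕ → E) => x i) (iidLaw μ) :=
    iIndepFun_infinitePi (X := fun _ => id) fun _ => measurable_id
  have hint : Integrable (fun x : ℕ → E => g (x 0)) (iidLaw μ) :=
    (measurePreserving_eval_infinitePi (fun _ => μ) 0).integrable_comp_of_integrable hg
  have hindep (i j : ℕ) (hij : i ≠ j) :
      (fun x : ℕ → E => g (x i)) ⟂ᵢ[iidLaw μ] fun x : ℕ → E => g (x j) :=
    (hcoord.indepFun hij).comp₀ (hlaw i).aemeasurable (hlaw j).aemeasurable (hgi i) (hgi j)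
  have hident (i : ℕ) : IdentDistrib (fun x : ℕ → E => g (x i)) (fun x : ℕ → E => g (x 0))
      (iidLaw μ) (iidLaw μ) :=
    ((hlaw i).identDistrib (hlaw 0)).comp_of_aemeasurable (hgi i)
  have hmean : ∫ x, g (x 0) ∂iidLaw μ = ∫ y, g y ∂μ :=
    (hlaw 0).integral_comp hg.aestronglyMeasurable
  have hslln := strong_law_ae_real (fun i (x : ℕ → E) => g (x i)) hint
    (fun i j hij => hindep i j hij) hident
  rwa [hmean] at hslln

theorem ae_iidLaw_eventually_exp_le_prod {u : E → ℝ≥0∞} (hu : ∀ᵐ y ∂μ, u y ≠ 0 ∧ u y ≠ ⊤)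
    (hi : Integrable (fun y => Real.log (u y).toReal) μ) {a : ℝ}
    (ha : a < ∫ y, Real.log (u y).toReal ∂μ) :
    ∀ᵐ x ∂iidLaw μ, ∀ᶠ n : ℕ in atTop,
      ENNReal.ofReal (Real.exp (a * n)) ≤ ∏ i ∈ Finset.range n, u (x i) := by
  filter_upwards [ae_iidLaw_tendsto_average hi, ae_iidLaw_forall hu] with x hx hux
  filter_upwards [hx.eventually_const_lt ha, eventually_gt_atTop 0] with n hn hn0
  have hexp (i : ℕ) : u (x i) = ENNReal.ofReal (Real.exp (Real.log (u (x i)).toReal)) := by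
    rw [Real.exp_log (ENNReal.toReal_pos (hux i).1 (hux i).2), ENNReal.ofReal_toReal (hux i).2]
  rw [Finset.prod_congr rfl fun i _ => hexp i,
    ← ENNReal.ofReal_prod_of_nonneg fun i _ => (Real.exp_pos _).le, ← Real.exp_sum]
  gcongr
  exact ((lt_div_iff₀ (by positivity)).1 hn).le

theorem lintegral_exp_mul_le {k : E → ℝ} (hk : AEMeasurable k μ) {M : ℝ} (hM : ∀ᵐ y ∂μ, ‖k y‖ ≤ M)
    (hmean : ∫ y, k y ∂μ ≤ 0) {t : ℝ} (ht : 0 ≤ t) : ∫⁻ y, ENNReal.ofReal (Real.exp (t * k y)) ∂μ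
      ≤ ENNReal.ofReal (Real.exp (M ^ 2 * t ^ 2 / 2)) := by
  have hIcc : ∀ᵐ y ∂μ, k y ∈ Set.Icc (-M) M := hM.mono fun y => abs_le.1
  have hsub := hasSubgaussianMGF_of_mem_Icc hk hIcc
  have hvar : (((‖M - -M‖₊ / 2) ^ 2 : NNReal) : ℝ) = M ^ 2 := by
    simp [← two_mul]
  calc ∫⁻ y, ENNReal.ofReal (Real.exp (t * k y)) ∂μ
      ≤ ∫⁻ y, ENNReal.ofReal (Real.exp (t * (k y - ∫ z, k z ∂μ))) ∂μ := by
        gcongr with y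
        linarith
    _ = ENNReal.ofReal (mgf (fun y => k y - ∫ z, k z ∂μ) μ t) :=
        (ofReal_integral_eq_lintegral_ofReal (hsub.integrable_exp_mul t)
          (ae_of_all _ fun y => (Real.exp_pos _).le)).symm
    _ ≤ ENNReal.ofReal (Real.exp (M ^ 2 * t ^ 2 / 2)) := by
        have hmgf := hsub.mgf_le t
        rw [hvar] at hmgf
        exact ENNReal.ofReal_le_ofReal hmgf

end

section

variable {α β : Type*} [MeasurableSpace α] [MeasurableSpace β]

theorem ae_tendsto_zero_of_lintegral_le_geometric {μ : Measure α} {F : ℕ → α → ℝ≥0∞}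
    (hF : ∀ n, AEMeasurable (F n) μ) {C ρ : ℝ≥0∞} (hC : C ≠ ⊤) (hρ : ρ < 1)
    (h : ∀ n, ∫⁻ x, F n x ∂μ ≤ C * ρ ^ n) : ∀ᵐ x ∂μ, Tendsto (fun n => F n x) atTop (𝓝 0) := by
  have hsum : ∫⁻ x, ∑' n, F n x ∂μ ≠ ⊤ := by
    rw [lintegral_tsum hF]
    refine ne_top_of_le_ne_top ?_ (ENNReal.tsum_le_tsum h)
    rw [ENNReal.tsum_mul_left, ENNReal.tsum_geometric]
    exact ENNReal.mul_ne_top hC (ENNReal.inv_ne_top.2 (tsub_pos_of_lt hρ).ne')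
  filter_upwards [ae_lt_top' (AEMeasurable.tsum hF) hsum] with x hx
  exact ENNReal.tendsto_atTop_zero_of_tsum_ne_top hx.ne

theorem ae_tendsto_lintegral_top {μ : Measure α} [SFinite μ] (hμ : μ ≠ 0) {ν : Measure β}
    [SFinite ν] {G : ℕ → α → β → ℝ≥0∞} (hG : ∀ n, Measurable (Function.uncurry (G n)))
    (h : ∀ᵐ a ∂μ, ∀ᵐ b ∂ν, Tendsto (fun n => G n a b) atTop (𝓝 ⊤)) :
    ∀ᵐ b ∂ν, Tendsto (fun n => ∫⁻ a, G n a b ∂μ) atTop (𝓝 ⊤) := by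
  have hmeas : MeasurableSet {z : α × β | Tendsto (fun n => G n z.1 z.2) atTop (𝓝 ⊤)} :=
    measurableSet_tendsto (𝓝 ⊤) hG
  rw [Measure.ae_ae_comm hmeas] at h
  filter_upwards [h] with b hb
  have hfatou : ∫⁻ a, liminf (fun n => G n a b) atTop ∂μ
      ≤ liminf (fun n => ∫⁻ a, G n a b ∂μ) atTop :=
    lintegral_liminf_le fun n => (hG n).comp measurable_prodMk_right
  have htop : ∫⁻ a, liminf (fun n => G n a b) atTop ∂μ = ⊤ := by
    rw [lintegral_congr_ae (hb.mono fun a ha => ha.liminf_eq), lintegral_const,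
      ENNReal.top_mul (Measure.measure_univ_ne_zero.2 hμ)]
  exact tendsto_of_le_liminf_of_limsup_le (htop.ge.trans hfatou) le_top

theorem lintegral_div_mul_withDensity_le {ν : Measure α} {u v w : α → ℝ≥0∞} (hu : Measurable u)
    (hv : Measurable v) (hw : Measurable w) :
    ∫⁻ x, u x / v x * w x ∂ν.withDensity v ≤ ∫⁻ x, w x ∂ν.withDensity u := by
  rw [lintegral_withDensity_eq_lintegral_mul _ hu hw]
  refine (lintegral_withDensity_le_lintegral_mul ν hv _).trans (lintegral_mono fun x => ?_)
  calc v x * (u x / v x * w x) = v x * (u x / v x) * w x := (mul_assoc _ _ _).symm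
    _ ≤ u x * w x := by gcongr; exact ENNReal.mul_div_le

theorem one_sub_div_compl_le_div (μ : Measure α) (h0 : μ Set.univ ≠ 0) (ht : μ Set.univ ≠ ⊤)
    (U Φ : Set α) : 1 - μ (U ∩ Φ)ᶜ / μ Set.univ ≤ μ (U ∩ Φ) / μ Φ := by
  rw [tsub_le_iff_right]
  calc (1 : ℝ≥0∞) = μ Set.univ / μ Set.univ := (ENNReal.div_self h0 ht).symm
    _ ≤ (μ (U ∩ Φ) + μ (U ∩ Φ)ᶜ) / μ Set.univ := by
        gcongr
        rw [← Set.union_compl_self (U ∩ Φ)]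
        exact measure_union_le _ _
    _ = μ (U ∩ Φ) / μ Set.univ + μ (U ∩ Φ)ᶜ / μ Set.univ := ENNReal.add_div
    _ ≤ μ (U ∩ Φ) / μ Φ + μ (U ∩ Φ)ᶜ / μ Set.univ := by gcongr; exact Set.subset_univ Φ

end

theorem toENNReal_log_eq_ofReal {u : ℝ≥0∞} (h0 : u ≠ 0) (ht : u ≠ ⊤) :
    (ENNReal.log u).toENNReal = ENNReal.ofReal (Real.log u.toReal) := by
  rw [ENNReal.log_pos_real h0 ht, EReal.real_coe_toENNReal]

theorem toENNReal_neg_log_eq_ofReal {u : ℝ≥0∞} (h0 : u ≠ 0) (ht : u ≠ ⊤) :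
    (-ENNReal.log u).toENNReal = ENNReal.ofReal (-Real.log u.toReal) := by
  rw [ENNReal.log_pos_real h0 ht, ← EReal.coe_neg, EReal.real_coe_toENNReal]

theorem toENNReal_log_le_add_div {u v : ℝ≥0∞} (h0 : v ≠ 0) (ht : v ≠ ⊤) :
    (ENNReal.log u).toENNReal ≤ (ENNReal.log v).toENNReal + u / v := by
  rcases eq_or_ne u 0 with rfl | hu0
  · simp
  rcases eq_or_ne u ⊤ with rfl | hut
  · simp [ENNReal.top_div_of_ne_top ht]
  have hu : 0 < u.toReal := ENNReal.toReal_pos hu0 hut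
  have hv : 0 < v.toReal := ENNReal.toReal_pos h0 ht
  have hlog : Real.log u.toReal ≤ Real.log v.toReal + u.toReal / v.toReal := by
    have := Real.log_le_sub_one_of_pos (div_pos hu hv)
    rw [Real.log_div hu.ne' hv.ne'] at this
    linarith
  calc (ENNReal.log u).toENNReal
      ≤ ENNReal.ofReal (Real.log v.toReal + u.toReal / v.toReal) := by
        rw [toENNReal_log_eq_ofReal hu0 hut]
        exact ENNReal.ofReal_le_ofReal hlog
    _ ≤ ENNReal.ofReal (Real.log v.toReal) + ENNReal.ofReal (u.toReal / v.toReal) :=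
        ENNReal.ofReal_add_le
    _ = (ENNReal.log v).toENNReal + u / v := by
        rw [toENNReal_log_eq_ofReal h0 ht, ENNReal.ofReal_div_of_pos hv,
          ENNReal.ofReal_toReal hut, ENNReal.ofReal_toReal ht]

theorem toENNReal_neg_log_le_add {u v c : ℝ≥0∞} (hc0 : c ≠ 0) (hct : c ≠ ⊤) (h : c * v ≤ u) :
    (-ENNReal.log u).toENNReal ≤ (-ENNReal.log c).toENNReal + (-ENNReal.log v).toENNReal := by
  simp only [← ENNReal.log_inv]
  refine le_trans (EReal.toENNReal_le_toENNReal ?_) EReal.toENNReal_add_le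
  rw [← ENNReal.log_mul_add, ← ENNReal.mul_inv (Or.inl hc0) (Or.inl hct)]
  exact ENNReal.log_le_log (ENNReal.inv_le_inv.2 h)

-- The convex function `s ↦ u / ((1 - s) * u + s * v)` lies below its chord.
theorem mul_one_sub_div_lt_log_sub_log {u v t : ℝ} (hu : 0 < u) (hv : 0 < v) (ht : 0 < t)
    (ht1 : t < 1) (huv : u ≠ v) :
    t * (1 - u / v) < Real.log ((1 - t) * u + t * v) - Real.log u := by
  have : 0 < 1 - t := sub_pos.2 ht1
  have hw : 0 < (1 - t) * u + t * v := by positivity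
  have hne : u / ((1 - t) * u + t * v) ≠ 1 := by
    rw [Ne, div_eq_one_iff_eq hw.ne']
    intro h
    exact huv (mul_left_cancel₀ ht.ne' (by linarith))
  have hlog := Real.log_lt_sub_one_of_pos (div_pos hu hw) hne
  rw [Real.log_div hu.ne' hw.ne'] at hlog
  have hchord : u / ((1 - t) * u + t * v) ≤ 1 - t + t * (u / v) := by
    rw [div_le_iff₀ hw, show (1 - t + t * (u / v)) * ((1 - t) * u + t * v)
      = u + t * (1 - t) * (u - v) ^ 2 / v by field_simp; ring]
    have : 0 ≤ t * (1 - t) * (u - v) ^ 2 / v := by positivity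
    linarith
  linarith

namespace DomProb

theorem measurable_pdf (q : DomProb) : Measurable q.pdf :=
  Measure.measurable_rnDeriv _ _

theorem withDensity_pdf (q : DomProb) : volume.withDensity q.pdf = q.toMeasure :=
  Measure.withDensity_rnDeriv_eq _ _ q.2

theorem ae_of_ae_volume (r : DomProb) {p : ℝ → Prop} (h : ∀ᵐ x, p x) : ∀ᵐ x ∂r.toMeasure, p x :=
  Measure.AbsolutelyContinuous.ae_le r.2 h

theorem ae_pdf_ne_top (q r : DomProb) : ∀ᵐ x ∂r.toMeasure, q.pdf x ≠ ⊤ :=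
  r.ae_of_ae_volume (Measure.rnDeriv_ne_top _ _)

theorem ae_pdf_self_ne_zero (r : DomProb) : ∀ᵐ x ∂r.toMeasure, r.pdf x ≠ 0 :=
  (Measure.rnDeriv_pos (μ := r.toMeasure) r.2).mono fun _ hx => hx.ne'

theorem eq_of_pdf_ae_eq {q r : DomProb} (h : q.pdf =ᵐ[r.toMeasure] r.pdf) : q = r := by
  rw [← withDensity_pdf r, EventuallyEq, ae_withDensity_iff r.measurable_pdf] at h
  have hle : r.toMeasure ≤ q.toMeasure := by
    rw [← withDensity_pdf r, ← withDensity_pdf q]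
    refine withDensity_mono (h.mono fun x hx => ?_)
    by_cases h0 : r.pdf x = 0
    · simp [h0]
    · exact (hx h0).ge
  exact Subtype.ext (Subtype.ext (Measure.eq_of_le_of_isProbabilityMeasure hle).symm)

theorem lintegral_pdf_div_le_one (q r : DomProb) :
    ∫⁻ x, q.pdf x / r.pdf x ∂r.toMeasure ≤ 1 := by
  have hle := lintegral_div_mul_withDensity_le (ν := volume) q.measurable_pdf r.measurable_pdf
    measurable_one
  rw [withDensity_pdf, withDensity_pdf] at hle
  simpa using hle

theorem integrable_toReal_pdf_div (q r : DomProb) :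
    Integrable (fun x => (q.pdf x / r.pdf x).toReal) r.toMeasure :=
  integrable_toReal_of_lintegral_ne_top (q.measurable_pdf.div r.measurable_pdf).aemeasurable
    (ne_top_of_le_ne_top ENNReal.one_ne_top (q.lintegral_pdf_div_le_one r))

theorem integral_toReal_pdf_div_le_one (q r : DomProb) :
    ∫ x, (q.pdf x / r.pdf x).toReal ∂r.toMeasure ≤ 1 := by
  have hm : Measurable fun x => q.pdf x / r.pdf x := q.measurable_pdf.div r.measurable_pdf
  have hle := q.lintegral_pdf_div_le_one r
  rw [integral_toReal hm.aemeasurable (ae_lt_top hm (ne_top_of_le_ne_top ENNReal.one_ne_top hle))]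
  exact ENNReal.toReal_le_of_le_ofReal zero_le_one (by simpa using hle)

/-- The integral `∫ p log⁺ q` of the positive part in `Ldiv q p`. -/
noncomputable def logPosIntegral (q p : DomProb) : ℝ≥0∞ :=
  ∫⁻ x, (ENNReal.log (q.pdf x)).toENNReal ∂p.toMeasure

/-- The integral `∫ p log⁻ q` of the negative part in `Ldiv q p`. -/
noncomputable def logNegIntegral (q p : DomProb) : ℝ≥0∞ :=
  ∫⁻ x, (-ENNReal.log (q.pdf x)).toENNReal ∂p.toMeasure

theorem Ldiv_eq_neg_sub (q p : DomProb) :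
    Ldiv q p = -((logPosIntegral q p : EReal) - (logNegIntegral q p : EReal)) := rfl

theorem logNegIntegral_ne_top_iff {q p : DomProb} : logNegIntegral q p ≠ ⊤ ↔ Ldiv q p ≠ ⊤ := by
  rw [Ldiv_eq_neg_sub, Ne, Ne, EReal.neg_eq_top_iff, sub_eq_add_neg, EReal.add_eq_bot_iff,
    EReal.neg_eq_bot_iff, EReal.coe_ennreal_eq_top_iff]
  simp

theorem logPosIntegral_ne_top {q p : DomProb} (ht : Ldiv q p ≠ ⊤) (hb : Ldiv q p ≠ ⊥) :
    logPosIntegral q p ≠ ⊤ := by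
  intro h
  lift logNegIntegral q p to NNReal using logNegIntegral_ne_top_iff.2 ht with b hbeq
  rw [Ldiv_eq_neg_sub, h, ← hbeq] at hb
  exact hb (by simp)

theorem Ldiv_ne_bot {q p : DomProb} (h : logPosIntegral q p ≠ ⊤) : Ldiv q p ≠ ⊥ := by
  rw [Ldiv_eq_neg_sub, Ne, EReal.neg_eq_bot_iff, sub_eq_add_neg]
  exact EReal.add_ne_top (by simpa using h) (by simp)

theorem ae_pdf_ne_zero {q p : DomProb} (ht : Ldiv q p ≠ ⊤) : ∀ᵐ x ∂p.toMeasure, q.pdf x ≠ 0 := by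
  have hm : Measurable fun x => (-ENNReal.log (q.pdf x)).toENNReal :=
    q.measurable_pdf.ennreal_log.neg.ereal_toENNReal
  filter_upwards [ae_lt_top hm (logNegIntegral_ne_top_iff.2 ht)] with x hx h0
  simp [h0] at hx

theorem lintegral_ofReal_log_pdf {q p : DomProb} (ht : Ldiv q p ≠ ⊤) :
    ∫⁻ x, ENNReal.ofReal (Real.log (q.pdf x).toReal) ∂p.toMeasure = logPosIntegral q p :=
  lintegral_congr_ae <| by
    filter_upwards [ae_pdf_ne_zero ht, q.ae_pdf_ne_top p] with x h0 ht
      using (toENNReal_log_eq_ofReal h0 ht).symm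

theorem lintegral_ofReal_neg_log_pdf {q p : DomProb} (ht : Ldiv q p ≠ ⊤) :
    ∫⁻ x, ENNReal.ofReal (-Real.log (q.pdf x).toReal) ∂p.toMeasure = logNegIntegral q p :=
  lintegral_congr_ae <| by
    filter_upwards [ae_pdf_ne_zero ht, q.ae_pdf_ne_top p] with x h0 ht
      using (toENNReal_neg_log_eq_ofReal h0 ht).symm

theorem integrable_log_pdf {q p : DomProb} (ht : Ldiv q p ≠ ⊤) (hb : Ldiv q p ≠ ⊥) :
    Integrable (fun x => Real.log (q.pdf x).toReal) p.toMeasure := by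
  have hm : Measurable fun x => Real.log (q.pdf x).toReal :=
    Real.measurable_log.comp q.measurable_pdf.ennreal_toReal
  have hpos := logPosIntegral_ne_top ht hb
  have hneg := logNegIntegral_ne_top_iff.2 ht
  rw [← lintegral_ofReal_log_pdf ht] at hpos
  rw [← lintegral_ofReal_neg_log_pdf ht] at hneg
  refine ⟨hm.aestronglyMeasurable, ?_⟩
  rw [hasFiniteIntegral_iff_norm]
  calc ∫⁻ x, ENNReal.ofReal ‖Real.log (q.pdf x).toReal‖ ∂p.toMeasure
      ≤ ∫⁻ x, (ENNReal.ofReal (Real.log (q.pdf x).toReal)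
        + ENNReal.ofReal (-Real.log (q.pdf x).toReal)) ∂p.toMeasure := by
        gcongr with x
        rcases abs_choice (Real.log (q.pdf x).toReal) with h | h <;> simp [Real.norm_eq_abs, h]
    _ < ⊤ := by
        rw [lintegral_add_left hm.ennreal_ofReal]
        exact ENNReal.add_lt_top.2 ⟨hpos.lt_top, hneg.lt_top⟩

theorem Ldiv_eq_neg_integral {q p : DomProb} (ht : Ldiv q p ≠ ⊤) (hb : Ldiv q p ≠ ⊥) :
    Ldiv q p = ((-∫ x, Real.log (q.pdf x).toReal ∂p.toMeasure : ℝ) : EReal) := by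
  rw [integral_eq_lintegral_pos_part_sub_lintegral_neg_part (integrable_log_pdf ht hb),
    lintegral_ofReal_log_pdf ht, lintegral_ofReal_neg_log_pdf ht, Ldiv_eq_neg_sub, EReal.coe_neg,
    EReal.coe_sub, EReal.coe_ennreal_toReal (logPosIntegral_ne_top ht hb),
    EReal.coe_ennreal_toReal (logNegIntegral_ne_top_iff.2 ht)]

theorem Ldiv_ne_bot_of_self {q r : DomProb} (ht : Ldiv r r ≠ ⊤) (hb : Ldiv r r ≠ ⊥) :
    Ldiv q r ≠ ⊥ := by
  have hm : Measurable fun x => (ENNReal.log (r.pdf x)).toENNReal :=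
    r.measurable_pdf.ennreal_log.ereal_toENNReal
  have hle : logPosIntegral q r ≤ logPosIntegral r r + 1 :=
    calc logPosIntegral q r
        ≤ ∫⁻ x, ((ENNReal.log (r.pdf x)).toENNReal + q.pdf x / r.pdf x) ∂r.toMeasure :=
          lintegral_mono_ae <| by
            filter_upwards [r.ae_pdf_self_ne_zero, r.ae_pdf_ne_top r] with x h0 ht
              using toENNReal_log_le_add_div h0 ht
      _ ≤ logPosIntegral r r + 1 := by
          rw [lintegral_add_left hm]
          exact add_le_add_right (q.lintegral_pdf_div_le_one r) _
  exact Ldiv_ne_bot (ne_top_of_le_ne_top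
    (ENNReal.add_ne_top.2 ⟨logPosIntegral_ne_top ht hb, ENNReal.one_ne_top⟩) hle)

variable {f : DomProb → ℝ → ℝ≥0∞}

theorem IsDensityVersion.measurable_apply (hf : IsDensityVersion f) (q : DomProb) :
    Measurable (f q) :=
  hf.measurable.comp measurable_prodMk_left

theorem IsDensityVersion.ae_eq_pdf (hf : IsDensityVersion f) (q r : DomProb) :
    f q =ᵐ[r.toMeasure] q.pdf := by
  have h := Measure.rnDeriv_withDensity volume (hf.measurable_apply q)
  rw [hf.withDensity_eq q] at h
  exact r.ae_of_ae_volume h.symm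

theorem measurable_Ldiv (p : DomProb) : Measurable fun q => Ldiv q p := by
  obtain ⟨f, hf⟩ := exists_isDensityVersion
  have hlog : Measurable fun z : DomProb × ℝ => ENNReal.log (f z.1 z.2) := hf.measurable.ennreal_log
  have hpos : Measurable fun q => logPosIntegral q p := by
    have heq (q : DomProb) : logPosIntegral q p
        = ∫⁻ x, (ENNReal.log (f q x)).toENNReal ∂p.toMeasure :=
      lintegral_congr_ae ((hf.ae_eq_pdf q p).mono fun x hx => by simp only [hx])
    simpa only [heq] using hlog.ereal_toENNReal.lintegral_prod_right'
  have hneg : Measurable fun q => logNegIntegral q p := by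
    have hlog' : Measurable fun z : DomProb × ℝ => -ENNReal.log (f z.1 z.2) := hlog.neg
    have heq (q : DomProb) : logNegIntegral q p
        = ∫⁻ x, (-ENNReal.log (f q x)).toENNReal ∂p.toMeasure :=
      lintegral_congr_ae ((hf.ae_eq_pdf q p).mono fun x hx => by simp only [hx])
    simpa only [heq] using hlog'.ereal_toENNReal.lintegral_prod_right'
  simp only [Ldiv_eq_neg_sub, sub_eq_add_neg]
  exact (hpos.coe_ereal_ennreal.add hneg.coe_ereal_ennreal.neg).neg

theorem measurableSet_LBall (δ : ℝ) (q p : DomProb) : MeasurableSet (LBall δ q p) :=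
  measurableSet_lt (measurable_Ldiv p) measurable_const

theorem tendsto_iff_forall_integral_tendsto {γ : Type*} {F : Filter γ} {u : γ → DomProb}
    {q : DomProb} : Tendsto u F (𝓝 q) ↔
      ∀ g : ℝ →ᵇ ℝ, Tendsto (fun i => ∫ x, g x ∂(u i).toMeasure) F (𝓝 (∫ x, g x ∂q.toMeasure)) := by
  have h : Topology.IsInducing fun q : DomProb => q.1 := ⟨rfl⟩
  rw [h.tendsto_nhds_iff, ProbabilityMeasure.tendsto_iff_forall_integral_tendsto]
  rfl

theorem continuous_integral (g : ℝ →ᵇ ℝ) : Continuous fun q : DomProb => ∫ x, g x ∂q.toMeasure :=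
  continuous_iff_continuousAt.2 fun _ => tendsto_iff_forall_integral_tendsto.1 tendsto_id g

/-- The mixture `(1 - t) q + t r`, used to move `q` towards `r` within a weak neighbourhood. -/
noncomputable def mix (t : unitInterval) (q r : DomProb) : DomProb :=
  ⟨⟨ENNReal.ofReal (1 - t) • q.toMeasure + ENNReal.ofReal t • r.toMeasure, ⟨by
      simp only [Measure.coe_add, Measure.coe_smul, Pi.add_apply, Pi.smul_apply, measure_univ,
        smul_eq_mul, mul_one]
      rw [← ENNReal.ofReal_add (sub_nonneg.2 t.2.2) t.2.1, sub_add_cancel, ENNReal.ofReal_one]⟩⟩,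
    Measure.AbsolutelyContinuous.add_left (Measure.AbsolutelyContinuous.smul_left q.2 _)
      (Measure.AbsolutelyContinuous.smul_left r.2 _)⟩

theorem toMeasure_mix (t : unitInterval) (q r : DomProb) : (mix t q r).toMeasure =
    ENNReal.ofReal (1 - t) • q.toMeasure + ENNReal.ofReal t • r.toMeasure := rfl

theorem tendsto_mix (q r : DomProb) : Tendsto (fun t => mix t q r) (𝓝 0) (𝓝 q) := by
  refine tendsto_iff_forall_integral_tendsto.2 fun g => ?_
  have hg (p : DomProb) : Integrable g p.toMeasure := g.integrable _
  have hmix (t : unitInterval) : ∫ x, g x ∂(mix t q r).toMeasure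
      = (1 - t) * ∫ x, g x ∂q.toMeasure + t * ∫ x, g x ∂r.toMeasure := by
    rw [toMeasure_mix, integral_add_measure ((hg q).smul_measure ENNReal.ofReal_ne_top)
      ((hg r).smul_measure ENNReal.ofReal_ne_top), integral_smul_measure, integral_smul_measure,
      ENNReal.toReal_ofReal (sub_nonneg.2 t.2.2), ENNReal.toReal_ofReal t.2.1, smul_eq_mul,
      smul_eq_mul]
  have hc : Continuous fun t : unitInterval =>
      (1 - (t : ℝ)) * ∫ x, g x ∂q.toMeasure + t * ∫ x, g x ∂r.toMeasure := by fun_prop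
  simpa [hmix] using hc.tendsto 0

theorem pdf_mix_ae_eq (t : unitInterval) (q r : DomProb) : (mix t q r).pdf =ᵐ[volume]
    fun x => ENNReal.ofReal (1 - t) * q.pdf x + ENNReal.ofReal t * r.pdf x := by
  have hq := q.measurable_pdf
  have hr := r.measurable_pdf
  refine (withDensity_eq_iff_of_sigmaFinite (mix t q r).measurable_pdf.aemeasurable
    (by fun_prop)).1 ?_
  rw [withDensity_pdf, toMeasure_mix, ← withDensity_pdf q, ← withDensity_pdf r,
    ← withDensity_smul _ hq, ← withDensity_smul _ hr, ← withDensity_add_left (by fun_prop)]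
  rfl

theorem ae_toReal_pdf_mix (t : unitInterval) (q r : DomProb) : ∀ᵐ x ∂r.toMeasure,
    ((mix t q r).pdf x).toReal = (1 - t) * (q.pdf x).toReal + t * (r.pdf x).toReal := by
  filter_upwards [r.ae_of_ae_volume (pdf_mix_ae_eq t q r), q.ae_pdf_ne_top r, r.ae_pdf_ne_top r]
    with x hx hq hr
  rw [hx, ENNReal.toReal_add (ENNReal.mul_ne_top ENNReal.ofReal_ne_top hq)
    (ENNReal.mul_ne_top ENNReal.ofReal_ne_top hr), ENNReal.toReal_mul, ENNReal.toReal_mul,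
    ENNReal.toReal_ofReal (sub_nonneg.2 t.2.2), ENNReal.toReal_ofReal t.2.1]

theorem Ldiv_mix_ne_top {t : unitInterval} (ht : t < 1) {q p : DomProb} (r : DomProb)
    (hq : Ldiv q p ≠ ⊤) : Ldiv (mix t q r) p ≠ ⊤ := by
  have ht : 0 < 1 - (t : ℝ) := sub_pos.2 ht
  set c := ENNReal.ofReal (1 - t) with hc
  have hmix : ∀ᵐ x ∂p.toMeasure, c * q.pdf x ≤ (mix t q r).pdf x :=
    (p.ae_of_ae_volume (pdf_mix_ae_eq t q r)).mono fun x hx => hx ▸ le_self_add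
  have hle : logNegIntegral (mix t q r) p ≤ (-ENNReal.log c).toENNReal + logNegIntegral q p :=
    calc logNegIntegral (mix t q r) p
        ≤ ∫⁻ x, ((-ENNReal.log c).toENNReal + (-ENNReal.log (q.pdf x)).toENNReal) ∂p.toMeasure :=
          lintegral_mono_ae <| hmix.mono fun x hx =>
            toENNReal_neg_log_le_add (ENNReal.ofReal_pos.2 ht).ne' ENNReal.ofReal_ne_top hx
      _ = (-ENNReal.log c).toENNReal + logNegIntegral q p := by
          rw [lintegral_add_left measurable_const, lintegral_const, measure_univ, mul_one]
          rfl
  refine logNegIntegral_ne_top_iff.1 (ne_top_of_le_ne_top (ENNReal.add_ne_top.2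
    ⟨?_, logNegIntegral_ne_top_iff.2 hq⟩) hle)
  rw [hc, ENNReal.log_ofReal_of_pos ht, ← EReal.coe_neg, EReal.real_coe_toENNReal]
  exact ENNReal.ofReal_ne_top

theorem ae_mul_one_sub_pdf_div_le_log_pdf_mix {q r : DomProb} (hq : Ldiv q r ≠ ⊤)
    {t : unitInterval} (ht0 : 0 < t) (ht1 : t < 1) : ∀ᵐ x ∂r.toMeasure,
      t * (1 - (q.pdf x / r.pdf x).toReal)
          ≤ Real.log ((mix t q r).pdf x).toReal - Real.log (q.pdf x).toReal ∧
        (t * (1 - (q.pdf x / r.pdf x).toReal)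
            = Real.log ((mix t q r).pdf x).toReal - Real.log (q.pdf x).toReal →
          q.pdf x = r.pdf x) := by
  filter_upwards [ae_toReal_pdf_mix t q r, ae_pdf_ne_zero hq, q.ae_pdf_ne_top r,
    r.ae_pdf_self_ne_zero, r.ae_pdf_ne_top r] with x hx hq0 hqt hr0 hrt
  rw [hx, ENNReal.toReal_div]
  rcases eq_or_ne (q.pdf x) (r.pdf x) with heq | hne
  · refine ⟨le_of_eq ?_, fun _ => heq⟩
    rw [heq, div_self (ENNReal.toReal_pos hr0 hrt).ne', ← add_mul, sub_add_cancel, one_mul,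
      sub_self, sub_self, mul_zero]
  · have hlt := mul_one_sub_div_lt_log_sub_log (ENNReal.toReal_pos hq0 hqt)
      (ENNReal.toReal_pos hr0 hrt) (t := t) ht0 ht1
      fun h => hne ((ENNReal.toReal_eq_toReal_iff' hqt hrt).1 h)
    exact ⟨hlt.le, fun h => absurd h hlt.ne⟩

theorem eq_of_Ldiv_le_Ldiv_mix {q r : DomProb} (ht : Ldiv q r ≠ ⊤) (hb : Ldiv q r ≠ ⊥)
    {t : unitInterval} (ht0 : 0 < t) (ht1 : t < 1) (hle : Ldiv q r ≤ Ldiv (mix t q r) r) :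
    q = r := by
  have hmt : Ldiv (mix t q r) r ≠ ⊤ := Ldiv_mix_ne_top ht1 r ht
  have hmb : Ldiv (mix t q r) r ≠ ⊥ := ((bot_lt_iff_ne_bot.2 hb).trans_le hle).ne'
  have hlogq := integrable_log_pdf ht hb
  have hlogm := integrable_log_pdf hmt hmb
  have hdiv : Integrable (fun x => 1 - (q.pdf x / r.pdf x).toReal) r.toMeasure :=
    (integrable_const 1).sub (q.integrable_toReal_pdf_div r)
  have hleft : 0 ≤ ∫ x, t * (1 - (q.pdf x / r.pdf x).toReal) ∂r.toMeasure := by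
    rw [integral_const_mul, integral_sub (integrable_const 1) (q.integrable_toReal_pdf_div r),
      integral_const, probReal_univ, one_smul]
    exact mul_nonneg t.2.1 (sub_nonneg.2 (q.integral_toReal_pdf_div_le_one r))
  have hright : ∫ x, (Real.log ((mix t q r).pdf x).toReal - Real.log (q.pdf x).toReal)
      ∂r.toMeasure ≤ 0 := by
    rw [Ldiv_eq_neg_integral ht hb, Ldiv_eq_neg_integral hmt hmb, EReal.coe_le_coe_iff] at hle
    rw [integral_sub hlogm hlogq]
    linarith
  have hmono := ae_mul_one_sub_pdf_div_le_log_pdf_mix ht ht0 ht1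
  have hae := (integral_eq_iff_of_ae_le (hdiv.const_mul _) (hlogm.sub hlogq)
    (hmono.mono fun x hx => hx.1)).1 (le_antisymm (integral_mono_ae (hdiv.const_mul _)
      (hlogm.sub hlogq) (hmono.mono fun x hx => hx.1)) (hright.trans hleft))
  refine eq_of_pdf_ae_eq ?_
  filter_upwards [hmono, hae] with x hx heq using hx.2 heq

theorem eq_of_isLocalMin_Ldiv {q r : DomProb} (h : IsLocalMin (fun p => Ldiv p r) q)
    (ht : Ldiv q r ≠ ⊤) (hb : Ldiv q r ≠ ⊥) : q = r := by
  have hmin : ∀ᶠ t in 𝓝[>] (0 : unitInterval), Ldiv q r ≤ Ldiv (mix t q r) r :=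
    ((tendsto_mix q r).eventually h).filter_mono nhdsWithin_le_nhds
  have hpos : ∀ᶠ t in 𝓝[>] (0 : unitInterval), 0 < t := self_mem_nhdsWithin
  have hlt : ∀ᶠ t in 𝓝[>] (0 : unitInterval), t < 1 :=
    mem_nhdsWithin_of_mem_nhds (Iio_mem_nhds zero_lt_one)
  have : (𝓝[>] (0 : unitInterval)).NeBot := nhdsGT_neBot_of_exists_gt ⟨1, zero_lt_one⟩
  obtain ⟨t, hmin, ht0, ht1⟩ := (hmin.and (hpos.and hlt)).exists
  exact eq_of_Ldiv_le_Ldiv_mix ht hb ht0 ht1 hmin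

/-- The prior weighted by the likelihood ratios of the first `n` observations with respect to `r`;
normalized, it is the posterior. -/
noncomputable def ratioMeasure (prior : Measure DomProb) (f : DomProb → ℝ → ℝ≥0∞) (r : DomProb)
    (x : ℕ → ℝ) (n : ℕ) : Measure DomProb :=
  prior.withDensity fun q => ∏ i ∈ Finset.range n, f q (x i) / f r (x i)

variable {prior : Measure DomProb} {q r : DomProb} {A B Φ U : Set DomProb}

theorem ratioMeasure_apply [SFinite prior] (x : ℕ → ℝ) (n : ℕ) (A : Set DomProb) :
    ratioMeasure prior f r x n A
      = ∫⁻ q in A, ∏ i ∈ Finset.range n, f q (x i) / f r (x i) ∂prior :=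
  withDensity_apply' _ _

theorem posterior_eq_ratioMeasure_div [SFinite prior] {x : ℕ → ℝ}
    (hx : ∀ i, f r (x i) ≠ 0 ∧ f r (x i) ≠ ⊤) (n : ℕ) (Q : Set DomProb) :
    posterior prior Φ f x n Q
      = ratioMeasure prior f r x n (Q ∩ Φ) / ratioMeasure prior f r x n Φ := by
  set c := ∏ i ∈ Finset.range n, (f r (x i))⁻¹
  have hc0 : c ≠ 0 := Finset.prod_ne_zero_iff.2 fun i _ => ENNReal.inv_ne_zero.2 (hx i).2
  have hct : c ≠ ⊤ := ENNReal.prod_ne_top fun i _ => ENNReal.inv_ne_top.2 (hx i).1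
  have hmass (S : Set DomProb) :
      ratioMeasure prior f r x n S = (∫⁻ q in S, likelihood f x n q ∂prior) * c := by
    rw [ratioMeasure_apply, ← lintegral_mul_const' c _ hct]
    simp only [likelihood, c, div_eq_mul_inv, Finset.prod_mul_distrib]
  rw [hmass, hmass, ENNReal.mul_div_mul_right _ _ hc0 hct, posterior]

namespace IsDensityVersion

variable (hf : IsDensityVersion f)
include hf

theorem ae_iidLaw_ne_zero_ne_top (r : DomProb) :
    ∀ᵐ x ∂iidLaw r.toMeasure, ∀ i, f r (x i) ≠ 0 ∧ f r (x i) ≠ ⊤ :=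
  ae_iidLaw_forall (p := fun y => f r y ≠ 0 ∧ f r y ≠ ⊤) <| by
    filter_upwards [hf.ae_eq_pdf r r, r.ae_pdf_self_ne_zero, r.ae_pdf_ne_top r] with y hy h0 ht
    exact ⟨hy ▸ h0, hy ▸ ht⟩

theorem lintegral_div_mul_le (q r : DomProb) {w : ℝ → ℝ≥0∞} (hw : Measurable w) :
    ∫⁻ y, f q y / f r y * w y ∂r.toMeasure ≤ ∫⁻ y, w y ∂q.toMeasure := by
  rw [← hf.withDensity_eq q, ← hf.withDensity_eq r]
  exact lintegral_div_mul_withDensity_le (hf.measurable_apply q) (hf.measurable_apply r) hw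

theorem measurable_prod_div (r : DomProb) (n : ℕ) : Measurable fun z : DomProb × (ℕ → ℝ) =>
    ∏ i ∈ Finset.range n, f z.1 (z.2 i) / f r (z.2 i) := by
  refine Finset.measurable_prod _ fun i _ => ?_
  have hcoord : Measurable fun z : DomProb × (ℕ → ℝ) => z.2 i :=
    (measurable_pi_apply i).comp measurable_snd
  exact (hf.measurable.comp (measurable_fst.prodMk hcoord)).div
    ((hf.measurable_apply r).comp hcoord)

theorem measurable_ratioMeasure_apply [SFinite prior] (n : ℕ) (A : Set DomProb) :
    Measurable fun x => ratioMeasure prior f r x n A := by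
  simp only [ratioMeasure_apply]
  exact (hf.measurable_prod_div r n).lintegral_prod_left'

theorem lintegral_prod_mul_ratioMeasure_le [SFinite prior] (hA : MeasurableSet A)
    {w : ℝ → ℝ≥0∞} (hw : Measurable w) {ρ : ℝ≥0∞}
    (hρ : ∀ q ∈ A, ∫⁻ y, w y ∂q.toMeasure ≤ ρ) (n : ℕ) :
    ∫⁻ x, (∏ i ∈ Finset.range n, w (x i)) * ratioMeasure prior f r x n A ∂iidLaw r.toMeasure
      ≤ prior A * ρ ^ n := by
  have hwn : Measurable fun x : ℕ → ℝ => ∏ i ∈ Finset.range n, w (x i) :=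
    Finset.measurable_prod _ fun i _ => hw.comp (measurable_pi_apply i)
  have hratio := hf.measurable_prod_div r n
  have hq (q : DomProb) (hq : q ∈ A) : ∫⁻ x, (∏ i ∈ Finset.range n, w (x i)) *
      ∏ i ∈ Finset.range n, f q (x i) / f r (x i) ∂iidLaw r.toMeasure ≤ ρ ^ n := by
    have hmeas : Measurable fun y => f q y / f r y * w y :=
      ((hf.measurable_apply q).div (hf.measurable_apply r)).mul hw
    simp only [← Finset.prod_mul_distrib, mul_comm (w _)]
    rw [lintegral_iidLaw_prod hmeas]
    gcongr
    exact (hf.lintegral_div_mul_le q r hw).trans (hρ q hq)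
  calc ∫⁻ x, (∏ i ∈ Finset.range n, w (x i)) * ratioMeasure prior f r x n A ∂iidLaw r.toMeasure
      = ∫⁻ x, ∫⁻ q in A, (∏ i ∈ Finset.range n, w (x i)) *
          ∏ i ∈ Finset.range n, f q (x i) / f r (x i) ∂prior ∂iidLaw r.toMeasure := by
        refine lintegral_congr fun x => ?_
        have hx : Measurable fun q => ∏ i ∈ Finset.range n, f q (x i) / f r (x i) :=
          hratio.comp measurable_prodMk_right
        rw [ratioMeasure_apply, lintegral_const_mul _ hx]
    _ = ∫⁻ q in A, ∫⁻ x, (∏ i ∈ Finset.range n, w (x i)) *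
          ∏ i ∈ Finset.range n, f q (x i) / f r (x i) ∂iidLaw r.toMeasure ∂prior :=
        lintegral_lintegral_swap
          ((hwn.comp measurable_fst).mul (hratio.comp measurable_swap)).aemeasurable
    _ ≤ ∫⁻ _ in A, ρ ^ n ∂prior := setLIntegral_mono' hA hq
    _ = prior A * ρ ^ n := by rw [setLIntegral_const, mul_comm]

theorem ae_ratioMeasure_univ_ne_top [IsFiniteMeasure prior] :
    ∀ᵐ x ∂iidLaw r.toMeasure, ∀ n, ratioMeasure prior f r x n Set.univ ≠ ⊤ := by
  refine ae_all_iff.2 fun n => ?_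
  have hle := hf.lintegral_prod_mul_ratioMeasure_le (prior := prior) (r := r) MeasurableSet.univ
    measurable_one (ρ := 1) (by simp) n
  simp only [Pi.one_apply, Finset.prod_const_one, one_mul, one_pow, mul_one] at hle
  exact (ae_lt_top (hf.measurable_ratioMeasure_apply n _)
    (ne_top_of_le_ne_top (measure_ne_top _ _) hle)).mono fun x hx => hx.ne

theorem ae_tendsto_pow_mul_prod_mul_ratioMeasure [IsFiniteMeasure prior] (hA : MeasurableSet A)
    {w : ℝ → ℝ≥0∞} (hw : Measurable w) {ρ s : ℝ≥0∞}
    (hρ : ∀ q ∈ A, ∫⁻ y, w y ∂q.toMeasure ≤ ρ) (hs : s * ρ < 1) :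
    ∀ᵐ x ∂iidLaw r.toMeasure, Tendsto (fun n => s ^ n *
      ((∏ i ∈ Finset.range n, w (x i)) * ratioMeasure prior f r x n A)) atTop (𝓝 0) := by
  have hm (n : ℕ) : Measurable fun x : ℕ → ℝ =>
      (∏ i ∈ Finset.range n, w (x i)) * ratioMeasure prior f r x n A :=
    (Finset.measurable_prod _ fun i _ => hw.comp (measurable_pi_apply i)).mul
      (hf.measurable_ratioMeasure_apply n A)
  refine ae_tendsto_zero_of_lintegral_le_geometric (fun n => ((hm n).const_mul _).aemeasurable)
    (measure_ne_top prior A) hs fun n => ?_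
  rw [lintegral_const_mul _ (hm n), mul_pow, mul_left_comm]
  gcongr
  exact hf.lintegral_prod_mul_ratioMeasure_le hA hw hρ n

end IsDensityVersion

/-- Almost surely under an i.i.d. sample from `r`, the integrated likelihood ratio of `A` decays
exponentially, at a rate that does not depend on the sample. -/
def ExpNegligible (prior : Measure DomProb) (f : DomProb → ℝ → ℝ≥0∞) (r : DomProb)
    (A : Set DomProb) : Prop :=
  ∃ c > 0, ∀ᵐ x ∂iidLaw r.toMeasure, Tendsto
    (fun n : ℕ => ENNReal.ofReal (Real.exp (c * n)) * ratioMeasure prior f r x n A) atTop (𝓝 0)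

theorem expNegligible_empty : ExpNegligible prior f r ∅ :=
  ⟨1, one_pos, ae_of_all _ fun x => by simp⟩

theorem ExpNegligible.mono (hB : ExpNegligible prior f r B) (h : A ⊆ B) :
    ExpNegligible prior f r A := by
  obtain ⟨c, hc, hB⟩ := hB
  refine ⟨c, hc, hB.mono fun x hx => tendsto_of_tendsto_of_tendsto_of_le_of_le
    tendsto_const_nhds hx (fun _ => zero_le) fun n => ?_⟩
  gcongr

theorem ExpNegligible.union (hA : ExpNegligible prior f r A) (hB : ExpNegligible prior f r B) :
    ExpNegligible prior f r (A ∪ B) := by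
  obtain ⟨a, ha, hA⟩ := hA
  obtain ⟨b, hb, hB⟩ := hB
  refine ⟨min a b, lt_min ha hb, ?_⟩
  filter_upwards [hA, hB] with x hxA hxB
  refine tendsto_of_tendsto_of_tendsto_of_le_of_le tendsto_const_nhds
    (by simpa only [add_zero] using hxA.add hxB) (fun _ => zero_le) fun n => ?_
  calc ENNReal.ofReal (Real.exp (min a b * n)) * ratioMeasure prior f r x n (A ∪ B)
      ≤ ENNReal.ofReal (Real.exp (min a b * n)) *
          (ratioMeasure prior f r x n A + ratioMeasure prior f r x n B) := by
        gcongr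
        exact measure_union_le _ _
    _ ≤ _ := by
        rw [mul_add]
        gcongr
        exacts [min_le_left a b, min_le_right a b]

/-- The filter of the sets whose complements are exponentially negligible. It is finer than `𝓝 r`,
and being a filter it reduces this to the subbasic neighbourhoods of `r`. -/
def coExpNegligible (prior : Measure DomProb) (f : DomProb → ℝ → ℝ≥0∞) (r : DomProb) :
    Filter DomProb :=
  Filter.comk (ExpNegligible prior f r) expNegligible_empty (fun _ hB _ h => hB.mono h)
    fun _ hA _ hB => hA.union hB

theorem IsDensityVersion.expNegligible_of_lintegral_exp_le [IsFiniteMeasure prior]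
    (hf : IsDensityVersion f) (hA : MeasurableSet A) {h : ℝ → ℝ} (hm : Measurable h)
    (hi : Integrable h r.toMeasure) {a : ℝ} (ha : a < ∫ y, h y ∂r.toMeasure)
    (hle : ∀ q ∈ A, ∫⁻ y, ENNReal.ofReal (Real.exp (h y)) ∂q.toMeasure
      ≤ ENNReal.ofReal (Real.exp a)) :
    ExpNegligible prior f r A := by
  obtain ⟨c, hc, hac⟩ : ∃ c > 0, a + 2 * c < ∫ y, h y ∂r.toMeasure :=
    ⟨(∫ y, h y ∂r.toMeasure - a) / 3, by linarith, by linarith⟩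
  have hlog (y : ℝ) : Real.log (ENNReal.ofReal (Real.exp (h y))).toReal = h y := by
    rw [ENNReal.toReal_ofReal (Real.exp_pos _).le, Real.log_exp]
  have hgrowth : ∀ᵐ x ∂iidLaw r.toMeasure, ∀ᶠ n : ℕ in atTop,
      ENNReal.ofReal (Real.exp ((a + 2 * c) * n))
        ≤ ∏ i ∈ Finset.range n, ENNReal.ofReal (Real.exp (h (x i))) :=
    ae_iidLaw_eventually_exp_le_prod
      (ae_of_all _ fun y => ⟨(ENNReal.ofReal_pos.2 (Real.exp_pos _)).ne', ENNReal.ofReal_ne_top⟩)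
      (by simpa only [hlog] using hi) (by simpa only [hlog] using hac)
  have hdecay := hf.ae_tendsto_pow_mul_prod_mul_ratioMeasure (prior := prior) (r := r) hA
    hm.exp.ennreal_ofReal hle (s := ENNReal.ofReal (Real.exp (-(a + c)))) <| by
      rw [← ENNReal.ofReal_mul (Real.exp_pos _).le, ← Real.exp_add]
      simpa using hc
  refine ⟨c, hc, ?_⟩
  filter_upwards [hgrowth, hdecay] with x hx hx0
  refine tendsto_of_tendsto_of_tendsto_of_le_of_le' tendsto_const_nhds hx0
    (Eventually.of_forall fun _ => zero_le) (hx.mono fun n hn => ?_)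
  calc ENNReal.ofReal (Real.exp (c * n)) * ratioMeasure prior f r x n A
      = ENNReal.ofReal (Real.exp (-(a + c))) ^ n *
          (ENNReal.ofReal (Real.exp ((a + 2 * c) * n)) * ratioMeasure prior f r x n A) := by
        rw [← mul_assoc, ← ENNReal.ofReal_pow (Real.exp_pos _).le, ← Real.exp_nat_mul,
          ← ENNReal.ofReal_mul (Real.exp_pos _).le, ← Real.exp_add]
        ring_nf
    _ ≤ _ := by gcongr

-- The test function is the tilt `t * k` with the optimal `t = ∫ k dr / ‖k‖ ^ 2`.
theorem IsDensityVersion.expNegligible_setOf_integral_nonpos [IsFiniteMeasure prior]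
    (hf : IsDensityVersion f) {k : ℝ →ᵇ ℝ} (hk : 0 < ∫ y, k y ∂r.toMeasure) :
    ExpNegligible prior f r {q | ∫ y, k y ∂q.toMeasure ≤ 0} := by
  set m := ∫ y, k y ∂r.toMeasure
  have hnorm : 0 < ‖k‖ := by
    rw [norm_pos_iff]
    rintro rfl
    simp [m] at hk
  have hkm : Measurable k := k.continuous.measurable
  set t := m / ‖k‖ ^ 2
  have ht : 0 < t := by positivity
  refine hf.expNegligible_of_lintegral_exp_le
    (isClosed_le (continuous_integral k) continuous_const).measurableSet (hkm.const_mul t)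
    ((k.integrable _).const_mul t) (a := ‖k‖ ^ 2 * t ^ 2 / 2) ?_ fun q hq =>
      lintegral_exp_mul_le hkm.aemeasurable (ae_of_all _ k.norm_coe_le_norm) hq ht.le
  have hhalf : ‖k‖ ^ 2 * t ^ 2 / 2 = t * m / 2 := by
    simp only [t]
    field_simp
  rw [integral_const_mul, hhalf]
  exact half_lt_self (mul_pos ht hk)

theorem nhds_le_of_forall_integral_pos {F : Filter DomProb}
    (h : ∀ k : ℝ →ᵇ ℝ, 0 < ∫ y, k y ∂r.toMeasure → ∀ᶠ q in F, 0 < ∫ y, k y ∂q.toMeasure) :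
    F ≤ 𝓝 r := by
  have hlt (k : ℝ →ᵇ ℝ) (a : ℝ) (ha : a < ∫ y, k y ∂r.toMeasure) :
      ∀ᶠ q in F, a < ∫ y, k y ∂q.toMeasure := by
    have hsub (q : DomProb) : ∫ y, (k - BoundedContinuousFunction.const ℝ a) y ∂q.toMeasure
        = ∫ y, k y ∂q.toMeasure - a := by
      simp [integral_sub (k.integrable q.toMeasure) (integrable_const a)]
    have := h (k - BoundedContinuousFunction.const ℝ a) (by rwa [hsub, sub_pos])
    simpa only [hsub, sub_pos] using this
  refine tendsto_iff_forall_integral_tendsto.2 fun k =>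
    tendsto_order.2 ⟨fun a ha => hlt k a ha, fun a ha => ?_⟩
  have := hlt (-k) (-a) (by simpa [integral_neg] using ha)
  simpa [integral_neg] using this

theorem IsDensityVersion.expNegligible_compl_of_mem_nhds [IsFiniteMeasure prior]
    (hf : IsDensityVersion f) {V : Set DomProb} (hV : V ∈ 𝓝 r) : ExpNegligible prior f r Vᶜ := by
  have hle : coExpNegligible prior f r ≤ 𝓝 r := nhds_le_of_forall_integral_pos fun k hk =>
    mem_comk.2 ((hf.expNegligible_setOf_integral_nonpos hk).mono fun q hq => by simpa using hq)
  exact mem_comk.1 (hle hV)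

theorem neg_lt_integral_log_sub_log_of_mem_LBall (ht : Ldiv r r ≠ ⊤) (hb : Ldiv r r ≠ ⊥) {c : ℝ}
    (hq : q ∈ LBall c r r) :
    -c < ∫ y, (Real.log (q.pdf y).toReal - Real.log (r.pdf y).toReal) ∂r.toMeasure := by
  have hqb : Ldiv q r ≠ ⊥ := Ldiv_ne_bot_of_self ht hb
  have hqt : Ldiv q r ≠ ⊤ := (lt_of_lt_of_le hq le_top).ne
  rw [LBall, Set.mem_ofPred_eq, Ldiv_eq_neg_integral hqt hqb, Ldiv_eq_neg_integral ht hb,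
    ← EReal.coe_add, EReal.coe_lt_coe_iff] at hq
  rw [integral_sub (integrable_log_pdf hqt hqb) (integrable_log_pdf ht hb)]
  linarith

theorem IsDensityVersion.ae_tendsto_exp_mul_prod_div (hf : IsDensityVersion f)
    (ht : Ldiv r r ≠ ⊤) (hb : Ldiv r r ≠ ⊥) {c : ℝ} (hq : q ∈ LBall c r r) :
    ∀ᵐ x ∂iidLaw r.toMeasure, Tendsto (fun n : ℕ => ENNReal.ofReal (Real.exp (c * n)) *
      ∏ i ∈ Finset.range n, f q (x i) / f r (x i)) atTop (𝓝 ⊤) := by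
  have hqb : Ldiv q r ≠ ⊥ := Ldiv_ne_bot_of_self ht hb
  have hqt : Ldiv q r ≠ ⊤ := (lt_of_lt_of_le hq le_top).ne
  have hqi := integrable_log_pdf hqt hqb
  have hri := integrable_log_pdf ht hb
  obtain ⟨a, hca, ha⟩ := exists_between (neg_lt_integral_log_sub_log_of_mem_LBall ht hb hq)
  have hdiv : ∀ᵐ y ∂r.toMeasure, (f q y / f r y ≠ 0 ∧ f q y / f r y ≠ ⊤) ∧
      Real.log (q.pdf y).toReal - Real.log (r.pdf y).toReal
        = Real.log (f q y / f r y).toReal := by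
    filter_upwards [hf.ae_eq_pdf q r, hf.ae_eq_pdf r r, ae_pdf_ne_zero hqt, q.ae_pdf_ne_top r,
      r.ae_pdf_self_ne_zero, r.ae_pdf_ne_top r] with y hqy hry hq0 hqt hr0 hrt
    rw [hqy, hry, ENNReal.toReal_div, Real.log_div (ENNReal.toReal_pos hq0 hqt).ne'
      (ENNReal.toReal_pos hr0 hrt).ne']
    exact ⟨⟨ENNReal.div_ne_zero.2 ⟨hq0, hrt⟩, ENNReal.div_ne_top hqt hr0⟩, rfl⟩
  have hlog := hdiv.mono fun y hy => hy.2
  have hgrowth := ae_iidLaw_eventually_exp_le_prod (hdiv.mono fun y hy => hy.1)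
    ((hqi.sub hri).congr hlog) (integral_congr_ae hlog ▸ ha)
  have hexp : Tendsto (fun n : ℕ => ENNReal.ofReal (Real.exp ((c + a) * n))) atTop (𝓝 ⊤) :=
    ENNReal.tendsto_ofReal_atTop.comp (Real.tendsto_exp_atTop.comp
      (tendsto_natCast_atTop_atTop.const_mul_atTop (by linarith)))
  filter_upwards [hgrowth] with x hx
  refine tendsto_nhds_top_mono hexp (hx.mono fun n hn => ?_)
  calc ENNReal.ofReal (Real.exp ((c + a) * n))
      = ENNReal.ofReal (Real.exp (c * n)) * ENNReal.ofReal (Real.exp (a * n)) := by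
        rw [← ENNReal.ofReal_mul (Real.exp_pos _).le, ← Real.exp_add, add_mul]
    _ ≤ _ := mul_le_mul_right hn _

theorem IsDensityVersion.ae_tendsto_exp_mul_ratioMeasure_univ [SFinite prior]
    (hf : IsDensityVersion f) (ht : Ldiv r r ≠ ⊤) (hb : Ldiv r r ≠ ⊥) {c : ℝ}
    (hc : prior (LBall c r r) ≠ 0) : ∀ᵐ x ∂iidLaw r.toMeasure, Tendsto
      (fun n : ℕ => ENNReal.ofReal (Real.exp (c * n)) * ratioMeasure prior f r x n Set.univ)
      atTop (𝓝 ⊤) := by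
  have hball : ∀ᵐ x ∂iidLaw r.toMeasure, Tendsto (fun n : ℕ => ∫⁻ q in LBall c r r,
      ENNReal.ofReal (Real.exp (c * n)) * ∏ i ∈ Finset.range n, f q (x i) / f r (x i) ∂prior)
      atTop (𝓝 ⊤) :=
    ae_tendsto_lintegral_top (by rwa [Ne, Measure.restrict_eq_zero])
      (fun n => (hf.measurable_prod_div r n).const_mul _)
      (ae_restrict_of_forall_mem (measurableSet_LBall c r r) fun q hq =>
        hf.ae_tendsto_exp_mul_prod_div ht hb hq)
  filter_upwards [hball] with x hx
  refine tendsto_nhds_top_mono hx (Eventually.of_forall fun n => ?_)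
  dsimp only
  rw [lintegral_const_mul' _ _ ENNReal.ofReal_ne_top, ← ratioMeasure_apply]
  gcongr
  exact Set.subset_univ _

theorem IsDensityVersion.ae_tendsto_posterior [IsFiniteMeasure prior] (hf : IsDensityVersion f)
    (ht : Ldiv r r ≠ ⊤) (hb : Ldiv r r ≠ ⊥) (hprior : ∀ δ : ℝ, 0 < δ → 0 < prior (LBall δ r r))
    (hΦ : Φ ∈ 𝓝 r) (hU : U ∈ 𝓝 r) :
    ∀ᵐ x ∂iidLaw r.toMeasure, Tendsto (fun n => posterior prior Φ f x n U) atTop (𝓝 1) := by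
  obtain ⟨c, hc, hneg⟩ := hf.expNegligible_compl_of_mem_nhds (prior := prior) (inter_mem hU hΦ)
  filter_upwards [hneg, hf.ae_tendsto_exp_mul_ratioMeasure_univ ht hb (hprior c hc).ne',
    hf.ae_ratioMeasure_univ_ne_top (prior := prior), hf.ae_iidLaw_ne_zero_ne_top r]
    with x hx0 hxtop hxfin hx
  have hratio : Tendsto (fun n => ratioMeasure prior f r x n (U ∩ Φ)ᶜ
      / ratioMeasure prior f r x n Set.univ) atTop (𝓝 0) := by
    have hdiv := ENNReal.Tendsto.div hx0 (Or.inr ENNReal.top_ne_zero) hxtop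
      (Or.inr ENNReal.zero_ne_top)
    rw [ENNReal.zero_div] at hdiv
    refine hdiv.congr fun n => ENNReal.mul_div_mul_left _ _ ?_ ENNReal.ofReal_ne_top
    exact (ENNReal.ofReal_pos.2 (Real.exp_pos _)).ne'
  have hlower : Tendsto (fun n => 1 - ratioMeasure prior f r x n (U ∩ Φ)ᶜ
      / ratioMeasure prior f r x n Set.univ) atTop (𝓝 1) := by
    simpa using ENNReal.Tendsto.sub tendsto_const_nhds hratio (Or.inl ENNReal.one_ne_top)
  refine tendsto_of_tendsto_of_tendsto_of_le_of_le' hlower tendsto_const_nhds ?_ ?_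
  · filter_upwards [hxtop.eventually_ne ENNReal.top_ne_zero] with n hn
    rw [posterior_eq_ratioMeasure_div hx]
    exact one_sub_div_compl_le_div _ (right_ne_zero_of_mul hn) (hxfin n) U Φ
  · refine Eventually.of_forall fun n => ?_
    rw [posterior_eq_ratioMeasure_div hx]
    exact ENNReal.div_le_of_le_mul (by rw [one_mul]; exact measure_mono Set.inter_subset_right)

theorem IsLProjection.isLocalMin_Ldiv (h : IsLProjection q Φ r) (hΦ : IsOpen Φ) :
    IsLocalMin (fun p => Ldiv p r) q :=
  Filter.eventually_of_mem (hΦ.mem_nhds h.1) h.2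

theorem IsLProjection.LdivSet_eq (h : IsLProjection q Φ r) : LdivSet Φ r = Ldiv q r :=
  le_antisymm (iInf₂_le q h.1) (le_iInf₂ h.2)

theorem MetrizesWeak.weakBall_mem_nhds {d : MetricSpace DomProb} (hd : MetrizesWeak d)
    (q : DomProb) {ε : ℝ} (hε : 0 < ε) : weakBall d q ε ∈ 𝓝 q := by
  rw [← hd]
  exact Metric.ball_mem_nhds q hε

end DomProb

theorem theorem2p2_general {Ω : Type*} [MeasurableSpace Ω] {P : Measure Ω}
    {r : DomProb} {X : ℕ → Ω → ℝ} (hX : ∀ i, HasLaw (X i) r.toMeasure P) (hindep : iIndepFun X P)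
    {prior : Measure DomProb} [IsFiniteMeasure prior]
    {f : DomProb → ℝ → ℝ≥0∞} (hf : DomProb.IsDensityVersion f) {Φ U : Set DomProb} {q₀ : DomProb}
    (hq₀ : IsLocalMin (fun q => DomProb.Ldiv q r) q₀) (hfin : DomProb.Ldiv q₀ r ≠ ⊤)
    (hprior : ∀ δ : ℝ, 0 < δ → 0 < prior (DomProb.LBall δ q₀ r)) (hΦ : Φ ∈ 𝓝 q₀) (hU : U ∈ 𝓝 q₀) :
    ∀ᵐ ω ∂P, Tendsto (fun n : ℕ => DomProb.posterior prior Φ f (fun i => X i ω) n U)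
      atTop (𝓝 1) := by
  have hbot : DomProb.Ldiv q₀ r ≠ ⊥ := fun h => by
    simpa [DomProb.LBall, h] using hprior 1 one_pos
  obtain rfl : q₀ = r := DomProb.eq_of_isLocalMin_Ldiv hq₀ hfin hbot
  have hlaw : HasLaw (fun ω i => X i ω) (iidLaw q₀.toMeasure) P :=
    hindep.hasLaw_infinitePi hX (aemeasurable_pi_iff.2 fun i => (hX i).aemeasurable)
  have hae := hf.ae_tendsto_posterior hfin hbot hprior hΦ hU
  rw [← hlaw.map_eq] at hae
  exact ae_of_ae_map hlaw.aemeasurable hae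

theorem theorem2p2
    {Ω : Type*} [MeasurableSpace Ω] (P : Measure Ω) [IsProbabilityMeasure P]
    -- the observations are i.i.d. with law `r`
    (r : DomProb) (X : ℕ → Ω → ℝ)
    (hX : ∀ i, HasLaw (X i) r.toMeasure P) (hindep : iIndepFun X P)
    -- the prior, and any jointly measurable version of the densities
    (prior : Measure DomProb) [IsProbabilityMeasure prior]
    (f : DomProb → ℝ → ℝ≥0∞) (hf : DomProb.IsDensityVersion f)
    -- the model
    (Φ : Set DomProb) (hΦ : IsOpen Φ)
    -- the Schwartz conditions
    (hprior : ∀ q ∈ Φ, ∀ δ : ℝ, 0 < δ → 0 < prior (DomProb.LBall δ q r))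
    (hL_top : DomProb.LdivSet Φ r < ⊤) (hL_bot : ⊥ < DomProb.LdivSet Φ r)
    -- weak balls centered at finitely many (at least one) L-projections of `r` on `Φ`
    (d : MetricSpace DomProb) (hd : DomProb.MetrizesWeak d)
    (ε : ℝ) (hε : 0 < ε)
    (κ : ℕ) (hκ : 0 < κ) (qhat : Fin κ → DomProb) (hqhat : ∀ k, DomProb.IsLProjection (qhat k) Φ r) :
    ∀ᵐ ω ∂P, Tendsto
      (fun n : ℕ => DomProb.posterior prior Φ f (fun i => X i ω) n (⋃ k, DomProb.weakBall d (qhat k) ε))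
      atTop (𝓝 1) :=
  theorem2p2_general hX hindep hf ((hqhat ⟨0, hκ⟩).isLocalMin_Ldiv hΦ)
    ((hqhat ⟨0, hκ⟩).LdivSet_eq ▸ hL_top).ne (hprior _ (hqhat ⟨0, hκ⟩).1)
    (hΦ.mem_nhds (hqhat ⟨0, hκ⟩).1)
    (mem_of_superset (hd.weakBall_mem_nhds _ hε) (Set.subset_iUnion_of_subset ⟨0, hκ⟩ subset_rfl))
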